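/- For an integer $n\ge 1$, let $\eta(n)$ denote the maximum of $e(G)/n^2$ over all $n$-vertex graphs $G$ in which every edge belongs to exactly one triangle, where $e(G)$ is the number of edges of $G$. (1) There exist absolute constants $c, C>0$ such that for all integers $D\ge 1$ and $n>(2D)^{100D}$, $$\eta(3n)\ \ge\ c\,D^{-C}\,(3/4)^{D/2}\,n^{-2/D}.$$ (2) There exist an absolute constant $c>0$ and a function $\varepsilon(n)$ with $\varepsilon(n)\to 0$ as $n\to\infty$ such that for all sufficiently large integers $n$, $$\eta(n)\ \ge\ c\cdot 2^{-\left(2\sqrt{\log_2(4/3)}+\varepsilon(n)\right)\sqrt{\log_2 n}}.$$ -/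

import Mathlib

open Filter Topology

/-- Every edge of `G` belongs to exactly one triangle (a triangle is a set of three pairwise
adjacent vertices). -/
def EdgesInUniqueTriangle {V : Type*} (G : SimpleGraph V) : Prop :=
  ∀ u v : V, G.Adj u v → ∃! t : Finset V, G.IsNClique 3 t ∧ u ∈ t ∧ v ∈ t

/-- The set of all values `e(G) / n ^ 2`, over the graphs `G` on `n` (labelled) vertices in which
every edge belongs to exactly one triangle. -/
def edgeDensities (n : ℕ) : Set ℝ :=
  {x | ∃ G : SimpleGraph (Fin n),
    EdgesInUniqueTriangle G ∧ x = (G.edgeSet.ncard : ℝ) / (n : ℝ) ^ 2}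

/-- `eta n` is the maximum of `e(G) / n ^ 2` over the `n`-vertex graphs `G` in which every edge
belongs to exactly one triangle. -/
noncomputable def eta (n : ℕ) : ℝ := sSup (edgeDensities n)

/-- The supremum in the definition of `eta` is a maximum. -/
theorem eta_isGreatest (n : ℕ) : IsGreatest (edgeDensities n) (eta n) := by
  have hfin : (edgeDensities n).Finite := by
    refine (Set.finite_range fun G : SimpleGraph (Fin n) =>
      (G.edgeSet.ncard : ℝ) / (n : ℝ) ^ 2).subset ?_
    rintro x ⟨G, -, rfl⟩
    exact ⟨G, rfl⟩
  have hne : (edgeDensities n).Nonempty :=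
    ⟨_, ⊥, fun u v h => absurd h (by simp), rfl⟩
  exact ⟨hne.csSup_mem hfin, fun x hx => le_csSup hfin.bddAbove hx⟩

theorem edgesInUniqueTriangle_iff_locallyLinear {V : Type*} {G : SimpleGraph V} :
    EdgesInUniqueTriangle G ↔ G.LocallyLinear := by
  constructor
  · refine fun h => ⟨fun s hs t ht hst a ha b hb => ?_, fun x y hxy => (h x y hxy).exists⟩
    by_contra hab
    exact hst ((h a b (hs.1 ha.1 hb.1 hab)).unique ⟨hs, ha.1, hb.1⟩ ⟨ht, ha.2, hb.2⟩)
  · intro h u v huv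
    refine existsUnique_of_exists_of_unique (h.2 huv) fun s t hs ht => ?_
    by_contra hst
    exact huv.ne (h.1 hs.1 ht.1 hst ⟨hs.2.1, ht.2.1⟩ ⟨hs.2.2, ht.2.2⟩)

/-- A locally linear graph on at most `n` vertices bounds `eta n` from below. -/
theorem SimpleGraph.LocallyLinear.edge_density_le_eta {V : Type*} [Fintype V] {G : SimpleGraph V}
    (hG : G.LocallyLinear) {n : ℕ} (hn : Fintype.card V ≤ n) :
    (G.edgeSet.ncard : ℝ) / (n : ℝ) ^ 2 ≤ eta n := by
  obtain ⟨f⟩ : Nonempty (V ↪ Fin n) :=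
    Function.Embedding.nonempty_of_card_le (by simpa using hn)
  refine (eta_isGreatest n).2
    ⟨G.map f, edgesInUniqueTriangle_iff_locallyLinear.2 (hG.map f), ?_⟩
  rw [SimpleGraph.edgeSet_map, Set.ncard_image_of_injective _ f.sym2Map.injective]

theorem eta_mul_sq_mono {m n : ℕ} (hm : 0 < m) (hmn : m ≤ n) :
    eta m * ((m : ℝ) / n) ^ 2 ≤ eta n := by
  obtain ⟨G, hG, h⟩ := (eta_isGreatest m).1
  have := (edgesInUniqueTriangle_iff_locallyLinear.1 hG).edge_density_le_eta (n := n) (by simpa)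
  rw [h]
  convert this using 1
  have : (m : ℝ) ≠ 0 := by positivity
  field_simp

/-- Disjointly indexed triangles without accidental ones bound `eta` from below. -/
theorem card_div_le_eta {α : Type*} [Fintype α] (t : Finset (α × α × α))
    [SimpleGraph.TripartiteFromTriangles.ExplicitDisjoint t]
    [SimpleGraph.TripartiteFromTriangles.NoAccidental t] {n : ℕ} (hn : Fintype.card α ≤ n) :
    (t.card : ℝ) / (3 * (n : ℝ) ^ 2) ≤ eta (3 * n) := by
  classical
  have hl := SimpleGraph.TripartiteFromTriangles.locallyLinear t
  have h := hl.edge_density_le_eta (n := 3 * n) (by simp; omega)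
  have hc := hl.card_edgeFinset
  rw [SimpleGraph.TripartiteFromTriangles.card_triangles] at hc
  rw [← SimpleGraph.coe_edgeFinset, Set.ncard_coe_finset, hc] at h
  refine le_trans (le_of_eq ?_) h
  push_cast
  rcases eq_or_ne (n : ℝ) 0 with h0 | h0
  · simp [h0]
  · field_simp

theorem eq_zero_of_parallelogram {ι : Type*} [Fintype ι] {s u : ι → ℤ} {r : ℤ}
    (h₀ : ∑ i, u i ^ 2 = r) (h₁ : ∑ i, (s i + u i) ^ 2 = r) (h₂ : ∑ i, (s i - u i) ^ 2 = r) :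
    s = 0 := by
  have h : ∑ i, s i ^ 2 = 0 := by
    have : ∑ i, ((s i + u i) ^ 2 + (s i - u i) ^ 2) = ∑ i, (2 * s i ^ 2 + 2 * u i ^ 2) :=
      Finset.sum_congr rfl fun i _ => by ring
    rw [Finset.sum_add_distrib, Finset.sum_add_distrib, ← Finset.mul_sum, ← Finset.mul_sum] at this
    linarith
  rw [Finset.sum_eq_zero_iff_of_nonneg fun i _ => sq_nonneg _] at h
  exact funext fun i => by simpa using h i (Finset.mem_univ i)

/-- If `B` is a symmetric set of at most `n` integer points, then the number of pairs of points of
`B` at a fixed distance with sum in `B` bounds `eta (3 * n)` from below. -/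
theorem card_fixed_distance_le_eta {ι : Type*} [Fintype ι] [DecidableEq ι] {n : ℕ}
    (B : Finset (ι → ℤ)) (hB : B.card ≤ n) (hneg : ∀ x ∈ B, -x ∈ B) (r : ℤ) :
    ((((B ×ˢ B).filter fun p => p.1 + p.2 ∈ B).filter
      fun p => ∑ i, (p.1 i - p.2 i) ^ 2 = r).card : ℝ) / (3 * (n : ℝ) ^ 2) ≤ eta (3 * n) := by
  set t : Finset (B × B × B) := Finset.univ.filter fun p =>
    (p.1 : ι → ℤ) + p.2.1 + p.2.2 = 0 ∧ ∑ i, ((p.1 : ι → ℤ) i - (p.2.1 : ι → ℤ) i) ^ 2 = r with ht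
  have hmem : ∀ a b c : B, (a, b, c) ∈ t ↔ (a : ι → ℤ) + b + c = 0 ∧
      ∑ i, ((a : ι → ℤ) i - (b : ι → ℤ) i) ^ 2 = r := by simp [ht]
  have : SimpleGraph.TripartiteFromTriangles.ExplicitDisjoint t := by
    constructor <;> intro a b c d h h' <;> rw [hmem] at h h' <;> refine Subtype.ext ?_
    · exact add_right_cancel (add_right_cancel (h.1.trans h'.1.symm))
    · exact add_left_cancel (add_right_cancel (h.1.trans h'.1.symm))
    · exact add_left_cancel (h.1.trans h'.1.symm)
  have : SimpleGraph.TripartiteFromTriangles.NoAccidental t := by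
    refine ⟨fun a a' b b' c c' h₁ h₂ h₃ => Or.inl ?_⟩
    rw [hmem] at h₁ h₂ h₃
    have e₁ : ∀ i, (a' : ι → ℤ) i + (b : ι → ℤ) i + (c : ι → ℤ) i = 0 := congr_fun h₁.1
    have e₂ : ∀ i, (a : ι → ℤ) i + (b' : ι → ℤ) i + (c : ι → ℤ) i = 0 := congr_fun h₂.1
    have hs := eq_zero_of_parallelogram (s := fun i => (a : ι → ℤ) i + (b : ι → ℤ) i + (c : ι → ℤ) i)
      (u := fun i => (a : ι → ℤ) i - (b : ι → ℤ) i) h₃.2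
      (by
        rw [← h₂.2]
        refine Finset.sum_congr rfl fun i _ => ?_
        rw [show (b' : ι → ℤ) i = -(a : ι → ℤ) i - (c : ι → ℤ) i by linarith [e₂ i]]
        ring)
      (by
        rw [← h₁.2]
        refine Finset.sum_congr rfl fun i _ => ?_
        rw [show (a' : ι → ℤ) i = -(b : ι → ℤ) i - (c : ι → ℤ) i by linarith [e₁ i]]
        ring)
    refine Subtype.ext (funext fun i => ?_)
    have := congr_fun hs i
    simp only [Pi.zero_apply] at this
    linarith [e₁ i]
  refine le_trans ?_ (card_div_le_eta t (n := n) (by simpa using hB))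
  gcongr
  refine Finset.card_le_card_of_surjOn (fun p => ((p.1 : ι → ℤ), (p.2.1 : ι → ℤ))) ?_
  rintro ⟨x, y⟩ h
  simp only [Finset.coe_filter, Finset.mem_filter, Finset.mem_product, Set.mem_ofPred_eq] at h
  obtain ⟨⟨⟨hx, hy⟩, hxy⟩, hr⟩ := h
  refine ⟨(⟨x, hx⟩, ⟨y, hy⟩, ⟨-(x + y), hneg _ hxy⟩), ?_, rfl⟩
  rw [Finset.mem_coe, hmem]
  exact ⟨by simp, hr⟩

/-- A pigeonhole over the possible distances. -/
theorem card_pairs_div_le_eta {ι : Type*} [Fintype ι] [DecidableEq ι] {n M : ℕ}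
    (B : Finset (ι → ℤ)) (hB : B.card ≤ n) (hneg : ∀ x ∈ B, -x ∈ B)
    (hM : ∀ x ∈ B, ∀ y ∈ B, ∑ i, (x i - y i) ^ 2 ≤ (M : ℤ)) :
    (((B ×ˢ B).filter fun p => p.1 + p.2 ∈ B).card : ℝ) / ((M + 1) * (3 * (n : ℝ) ^ 2))
      ≤ eta (3 * n) := by
  set P := (B ×ˢ B).filter fun p => p.1 + p.2 ∈ B with hP
  have hfib := Finset.card_eq_sum_card_fiberwise (s := P) (t := Finset.Icc (0 : ℤ) M)
    (f := fun p => ∑ i, (p.1 i - p.2 i) ^ 2) (fun p hp => by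
      simp only [hP, Finset.coe_filter, Finset.mem_product, Set.mem_ofPred_eq] at hp
      simp only [Finset.coe_Icc, Set.mem_Icc]
      exact ⟨Finset.sum_nonneg fun i _ => sq_nonneg _, hM _ hp.1.1 _ hp.1.2⟩)
  rw [← div_div, div_right_comm, div_le_iff₀ (by positivity), hfib]
  push_cast
  rw [Finset.sum_div]
  refine (Finset.sum_le_card_nsmul _ _ _ fun r _ =>
    card_fixed_distance_le_eta B hB hneg r).trans (le_of_eq ?_)
  simp [mul_comm]

theorem le_of_sq_eq {x y z : ℝ} (h : x ^ 2 = z) (hy : 0 ≤ y) (hz : z ≤ y ^ 2) : x ≤ y :=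
  (abs_le_of_sq_le_sq' (h.trans_le hz) hy).2

open MeasureTheory Metric in
/-- The ball of radius `ρ * r` is covered by `4 * D + 1` slabs orthogonal to `u`, of which the
central one is the largest and has a translate inside the lens. -/
theorem measureReal_closedBall_le_lens {E : Type*} [NormedAddCommGroup E] [InnerProductSpace ℝ E]
    [FiniteDimensional ℝ E] [MeasurableSpace E] [BorelSpace E] (μ : Measure E) [μ.IsAddHaarMeasure]
    {D : ℕ} (hD : 1 ≤ D) {r ρ : ℝ} (hr : 0 < r) (hρ₀ : 0 ≤ ρ)
    (hρ : ρ ^ 2 = 3 / 4 - 1 / (4 * (D : ℝ))) {u : E} (hu : ‖u‖ ≤ r) :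
    μ.real (closedBall 0 (ρ * r)) ≤ (4 * (D : ℝ) + 1) * μ.real {v | ‖v‖ ≤ r ∧ ‖u + v‖ ≤ r} := by
  have hD' : (1 : ℝ) ≤ D := by exact_mod_cast hD
  set δ : ℝ := r ^ 2 / (4 * D) with hδ
  have hδ₀ : 0 < δ := by positivity
  have hδr : 4 * D * δ = r ^ 2 := by rw [hδ]; field_simp
  have hρr : (ρ * r) ^ 2 = 3 / 4 * r ^ 2 - δ := by rw [mul_pow, hρ, hδ]; ring
  have hur : ‖u‖ ^ 2 ≤ r ^ 2 := by gcongr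
  set S : ℤ → Set E := fun k => {w | ‖w‖ ≤ ρ * r ∧ |inner ℝ w u - 2 * k * δ| ≤ δ} with hS
  have hlens : μ (S 0) ≤ μ {v | ‖v‖ ≤ r ∧ ‖u + v‖ ≤ r} := by
    rw [← measure_preimage_add_right μ (-((1 / 2 : ℝ) • u)) {v | ‖v‖ ≤ r ∧ ‖u + v‖ ≤ r}]
    refine measure_mono fun w hw => ?_
    obtain ⟨hw₁, hw₂⟩ := hw
    have hw₁' : ‖w‖ ^ 2 ≤ (ρ * r) ^ 2 := by gcongr
    rw [abs_le] at hw₂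
    push_cast at hw₂
    have e₁ : ‖w + -((1 / 2 : ℝ) • u)‖ ^ 2 = ‖w‖ ^ 2 - inner ℝ w u + ‖u‖ ^ 2 / 4 := by
      rw [← sub_eq_add_neg, norm_sub_sq_real, inner_smul_right, norm_smul]
      norm_num
      ring
    have e₂ : ‖u + (w + -((1 / 2 : ℝ) • u))‖ ^ 2 = ‖w‖ ^ 2 + inner ℝ w u + ‖u‖ ^ 2 / 4 := by
      rw [show u + (w + -((1 / 2 : ℝ) • u)) = w + (1 / 2 : ℝ) • u by module, norm_add_sq_real,
        inner_smul_right, norm_smul]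
      norm_num
      ring
    constructor
    · exact le_of_sq_eq e₁ hr.le (by nlinarith)
    · exact le_of_sq_eq e₂ hr.le (by nlinarith)
  have hcover : closedBall (0 : E) (ρ * r) ⊆ ⋃ k ∈ Finset.Icc (-(2 * D : ℤ)) (2 * D), S k := by
    intro w hw
    rw [mem_closedBall_zero_iff] at hw
    have hρ₁ : ρ ≤ 1 := by
      have : 0 < 1 / (4 * (D : ℝ)) := by positivity
      nlinarith
    have hin : |inner ℝ w u| ≤ 2 * D * (2 * δ) := by
      calc |inner ℝ w u| ≤ ‖w‖ * ‖u‖ := abs_real_inner_le_norm w u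
        _ ≤ (1 * r) * r := by gcongr; exact hw.trans (by gcongr)
        _ = 2 * D * (2 * δ) := by rw [one_mul, ← sq, ← hδr]; ring
    have hround := abs_sub_round (inner ℝ w u / (2 * δ))
    rw [abs_le] at hin hround
    have h₁ : inner ℝ w u / (2 * δ) ≤ 2 * D := by rw [div_le_iff₀ (by positivity)]; exact hin.2
    have h₂ : -(2 * D) ≤ inner ℝ w u / (2 * δ) := by
      rw [le_div_iff₀ (by positivity)]; linarith [hin.1]
    simp only [Set.mem_iUnion, Finset.mem_Icc]
    refine ⟨round (inner ℝ w u / (2 * δ)), ⟨?_, ?_⟩, hw, ?_⟩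
    · have : (-(2 * D : ℤ) : ℝ) < (round (inner ℝ w u / (2 * δ)) : ℝ) + 1 := by
        push_cast; linarith [hround.2]
      have : -(2 * D : ℤ) < round (inner ℝ w u / (2 * δ)) + 1 := by exact_mod_cast this
      omega
    · have : (round (inner ℝ w u / (2 * δ)) : ℝ) < (2 * D : ℤ) + 1 := by
        push_cast; linarith [hround.1]
      have : round (inner ℝ w u / (2 * δ)) < (2 * D : ℤ) + 1 := by exact_mod_cast this
      omega
    · have e : inner ℝ w u - 2 * (round (inner ℝ w u / (2 * δ)) : ℝ) * δ =
          2 * δ * (inner ℝ w u / (2 * δ) - round (inner ℝ w u / (2 * δ))) := by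
        field_simp
      rw [e, abs_le]
      constructor <;> nlinarith [hround.1, hround.2]
  have hslab : ∀ k, μ (S k) ≤ μ (S 0) := by
    intro k
    rcases eq_or_ne u 0 with rfl | hu₀
    · refine measure_mono fun w hw => ⟨hw.1, ?_⟩
      simpa using hδ₀.le
    have hu₁ : 0 < ‖u‖ ^ 2 := by positivity
    set t : ℝ := 2 * k * δ / ‖u‖ ^ 2 with ht
    have htu : t * ‖u‖ ^ 2 = 2 * k * δ := by rw [ht]; field_simp
    rw [← measure_preimage_add_right μ (-(t • u)) (S 0)]
    refine measure_mono fun w hw => ?_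
    obtain ⟨hw₁, hw₂⟩ := hw
    have e : inner ℝ (w + -(t • u)) u = inner ℝ w u - 2 * k * δ := by
      rw [← sub_eq_add_neg, inner_sub_left, inner_smul_left, real_inner_self_eq_norm_sq, ← htu]
      simp
    refine ⟨?_, by rw [e]; simpa using hw₂⟩
    have hn : ‖w + -(t • u)‖ ^ 2 = ‖w‖ ^ 2 - t * (2 * inner ℝ w u - 2 * k * δ) := by
      rw [← sub_eq_add_neg, norm_sub_sq_real, inner_smul_right, norm_smul, mul_pow, ← htu,
        Real.norm_eq_abs, sq_abs]
      ring
    refine le_trans (le_of_sq_eq hn (norm_nonneg w) ?_) hw₁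
    rw [abs_le] at hw₂
    have hk : 0 ≤ (k : ℝ) * (2 * inner ℝ w u - 2 * k * δ) := by
      rcases lt_trichotomy k 0 with h | rfl | h
      · have : (k : ℝ) ≤ -1 := by exact_mod_cast Int.le_sub_one_of_lt h
        exact mul_nonneg_of_nonpos_of_nonpos (by linarith) (by nlinarith [hw₂.2])
      · simp
      · have : (1 : ℝ) ≤ k := by exact_mod_cast h
        exact mul_nonneg (by linarith) (by nlinarith [hw₂.1])
    have : 0 ≤ t * (2 * inner ℝ w u - 2 * k * δ) := by
      rw [ht, show 2 * k * δ / ‖u‖ ^ 2 * (2 * inner ℝ w u - 2 * k * δ) =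
        2 * δ / ‖u‖ ^ 2 * (k * (2 * inner ℝ w u - 2 * k * δ)) by ring]
      positivity
    linarith
  have hfin : μ {v | ‖v‖ ≤ r ∧ ‖u + v‖ ≤ r} ≠ ⊤ :=
    ne_top_of_le_ne_top measure_closedBall_lt_top.ne
      (measure_mono (t := closedBall 0 r) fun v hv => mem_closedBall_zero_iff.2 hv.1)
  have key : μ (closedBall 0 (ρ * r)) ≤
      ((4 * D + 1 : ℕ) : ENNReal) * μ {v | ‖v‖ ≤ r ∧ ‖u + v‖ ≤ r} := by
    refine (measure_mono hcover).trans ((measure_biUnion_finset_le _ _).trans ?_)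
    refine (Finset.sum_le_card_nsmul _ _ _ fun k _ => (hslab k).trans hlens).trans (le_of_eq ?_)
    rw [nsmul_eq_mul, Int.card_Icc]
    congr 2
    omega
  have := ENNReal.toReal_mono (ENNReal.mul_ne_top (ENNReal.natCast_ne_top _) hfin) key
  rw [ENNReal.toReal_mul, ENNReal.toReal_natCast] at this
  simpa [Measure.real] using this

section Lattice
open MeasureTheory

variable {ι : Type*}

/-- An integer point as a point of Euclidean space. -/
noncomputable def intPoint (k : ι → ℤ) : EuclideanSpace ℝ ι := WithLp.toLp 2 fun i => (k i : ℝ)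

/-- The coordinatewise integer part. -/
noncomputable def floorPoint (v : EuclideanSpace ℝ ι) : ι → ℤ := fun i => ⌊v i⌋

theorem intPoint_add (k l : ι → ℤ) : intPoint (k + l) = intPoint k + intPoint l := by
  ext i; simp [intPoint]

theorem intPoint_neg (k : ι → ℤ) : intPoint (-k) = -intPoint k := by
  ext i; simp [intPoint]

variable [Fintype ι]

theorem norm_intPoint_sub_sq (k l : ι → ℤ) :
    ‖intPoint k - intPoint l‖ ^ 2 = ((∑ i, (k i - l i) ^ 2 : ℤ) : ℝ) := by
  rw [EuclideanSpace.norm_sq_eq]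
  simp [intPoint]

theorem norm_sub_intPoint_floorPoint (v : EuclideanSpace ℝ ι) :
    ‖v - intPoint (floorPoint v)‖ ≤ √(Fintype.card ι) := by
  rw [EuclideanSpace.norm_eq]
  refine Real.sqrt_le_sqrt ?_
  have : ∀ i ∈ Finset.univ, ‖(v - intPoint (floorPoint v)) i‖ ^ 2 ≤ (1 : ℝ) := fun i _ => by
    simp only [intPoint, floorPoint, PiLp.sub_apply, Real.norm_eq_abs, sq_abs]
    have h₁ := Int.floor_le (v i)
    have h₂ := Int.lt_floor_add_one (v i)
    nlinarith
  simpa using Finset.sum_le_card_nsmul _ _ _ this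

theorem volume_floorPoint_preimage (F : Finset (ι → ℤ)) :
    volume (floorPoint ⁻¹' (F : Set (ι → ℤ))) = F.card := by
  have hcube : ∀ k : ι → ℤ, floorPoint ⁻¹' {k} = (WithLp.ofLp : EuclideanSpace ℝ ι → ι → ℝ) ⁻¹'
      Set.univ.pi fun i => Set.Ico (k i : ℝ) (k i + 1) := by
    intro k
    ext v
    simp [floorPoint, funext_iff, Int.floor_eq_iff]
  have hmeas : ∀ k : ι → ℤ,
      MeasurableSet (Set.univ.pi fun i => Set.Ico (k i : ℝ) (k i + 1)) :=
    fun k => MeasurableSet.univ_pi fun i => measurableSet_Ico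
  rw [← sum_measure_preimage_singleton]
  · rw [Finset.sum_congr rfl (g := fun _ => 1)]
    · simp
    · intro k _
      rw [hcube, (PiLp.volume_preserving_ofLp ι).measure_preimage (hmeas k).nullMeasurableSet,
        volume_pi_pi]
      simp
  · intro k _
    rw [hcube]
    exact (PiLp.volume_preserving_ofLp ι).measurable (hmeas k)

/-- A set whose points have integer part in `F` has volume at most the number of points of `F`. -/
theorem measureReal_le_card {F : Finset (ι → ℤ)} {S : Set (EuclideanSpace ℝ ι)}
    (h : ∀ v ∈ S, floorPoint v ∈ F) : volume.real S ≤ F.card := by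
  have := ENNReal.toReal_mono (by simp)
    ((measure_mono (μ := volume) (t := floorPoint ⁻¹' (F : Set (ι → ℤ))) h).trans_eq
      (volume_floorPoint_preimage F))
  simpa [Measure.real] using this

theorem card_le_measureReal {F : Finset (ι → ℤ)} {S : Set (EuclideanSpace ℝ ι)}
    (hS : volume S ≠ ⊤) (h : ∀ v, floorPoint v ∈ F → v ∈ S) : (F.card : ℝ) ≤ volume.real S := by
  have := ENNReal.toReal_mono hS
    ((volume_floorPoint_preimage F).symm.trans_le (measure_mono (μ := volume) h))
  simpa [Measure.real] using this

theorem finite_intPoint_norm_le (R : ℝ) : {k : ι → ℤ | ‖intPoint k‖ ≤ R}.Finite := by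
  classical
  refine (Finset.finite_toSet (Fintype.piFinset fun _ : ι => Finset.Icc (-⌈R⌉) ⌈R⌉)).subset ?_
  intro k hk
  simp only [Finset.mem_coe, Fintype.mem_piFinset, Finset.mem_Icc]
  intro i
  have h : |(k i : ℝ)| ≤ ⌈R⌉ :=
    ((PiLp.norm_apply_le (intPoint k) i).trans hk).trans (Int.le_ceil R)
  rw [abs_le] at h
  exact_mod_cast h

/-- The integer points of the closed ball of radius `R` around the origin. -/
noncomputable def intBall (ι : Type*) [Fintype ι] (R : ℝ) : Finset (ι → ℤ) :=
  (finite_intPoint_norm_le (ι := ι) R).toFinset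

theorem mem_intBall {R : ℝ} {k : ι → ℤ} : k ∈ intBall ι R ↔ ‖intPoint k‖ ≤ R := by
  simp [intBall]

theorem floorPoint_mem_intBall {R : ℝ} {v : EuclideanSpace ℝ ι}
    (hv : ‖v‖ + √(Fintype.card ι) ≤ R) : floorPoint v ∈ intBall ι R := by
  rw [mem_intBall]
  have h := norm_sub_norm_le (intPoint (floorPoint v)) v
  rw [norm_sub_rev] at h
  linarith [norm_sub_intPoint_floorPoint v]

theorem card_intBall_le (R : ℝ) :
    ((intBall ι R).card : ℝ) ≤
      volume.real (Metric.closedBall (0 : EuclideanSpace ℝ ι) (R + √(Fintype.card ι))) := by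
  refine card_le_measureReal measure_closedBall_lt_top.ne fun v hv => ?_
  rw [mem_intBall] at hv
  rw [mem_closedBall_zero_iff]
  linarith [norm_sub_norm_le v (intPoint (floorPoint v)), norm_sub_intPoint_floorPoint v]

theorem le_card_intBall (R : ℝ) :
    volume.real (Metric.closedBall (0 : EuclideanSpace ℝ ι) (R - √(Fintype.card ι))) ≤
      (intBall ι R).card := by
  refine measureReal_le_card fun v hv => floorPoint_mem_intBall ?_
  rw [mem_closedBall_zero_iff] at hv
  linarith

/-- The pairs of integer points of a ball whose sum is in the ball, counted by volumes. -/
theorem le_card_intBall_pairs [DecidableEq ι] (hι : 1 ≤ Fintype.card ι) {r ρ : ℝ} (hr : 0 < r)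
    (hρ₀ : 0 ≤ ρ) (hρ : ρ ^ 2 = 3 / 4 - 1 / (4 * (Fintype.card ι : ℝ))) :
    volume.real (Metric.closedBall (0 : EuclideanSpace ℝ ι) (r - √(Fintype.card ι))) *
        volume.real (Metric.closedBall (0 : EuclideanSpace ℝ ι) (ρ * r)) /
          (4 * (Fintype.card ι : ℝ) + 1) ≤
      (((intBall ι (r + √(Fintype.card ι)) ×ˢ intBall ι (r + √(Fintype.card ι))).filter
        fun p => p.1 + p.2 ∈ intBall ι (r + √(Fintype.card ι))).card : ℝ) := by
  set B := intBall ι (r + √(Fintype.card ι)) with hB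
  set V := volume.real (Metric.closedBall (0 : EuclideanSpace ℝ ι) (ρ * r)) /
    (4 * (Fintype.card ι : ℝ) + 1) with hV
  have hfib : ∀ x ∈ intBall ι r, V ≤ ((B.filter fun y => x + y ∈ B).card : ℝ) := by
    intro x hx
    rw [mem_intBall] at hx
    rw [hV, div_le_iff₀' (by positivity)]
    refine (measureReal_closedBall_le_lens volume hι hr hρ₀ hρ hx).trans ?_
    gcongr
    refine measureReal_le_card fun v hv => ?_
    rw [Finset.mem_filter]
    refine ⟨floorPoint_mem_intBall (by linarith [hv.1]), ?_⟩
    rw [mem_intBall, intPoint_add]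
    have h := norm_sub_le (intPoint x + v) (v - intPoint (floorPoint v))
    rw [show intPoint x + v - (v - intPoint (floorPoint v)) =
      intPoint x + intPoint (floorPoint v) by abel] at h
    linarith [hv.2, norm_sub_intPoint_floorPoint v]
  have hsub : intBall ι r ⊆ B := fun x hx => by
    rw [mem_intBall] at hx ⊢
    linarith [Real.sqrt_nonneg (Fintype.card ι : ℝ)]
  have hcard : (((B ×ˢ B).filter fun p => p.1 + p.2 ∈ B).card : ℝ) =
      ∑ x ∈ B, ((B.filter fun y => x + y ∈ B).card : ℝ) := by
    rw [Finset.card_filter, Finset.sum_product]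
    simp only [Finset.card_filter]
    push_cast
    rfl
  have hV₀ : 0 ≤ V := by positivity
  rw [hcard, mul_div_assoc]
  calc _ ≤ ((intBall ι r).card : ℝ) * V := by gcongr; exact le_card_intBall r
    _ = ∑ x ∈ intBall ι r, V := by simp
    _ ≤ ∑ x ∈ intBall ι r, ((B.filter fun y => x + y ∈ B).card : ℝ) := Finset.sum_le_sum hfib
    _ ≤ _ := Finset.sum_le_sum_of_subset_of_nonneg hsub fun _ _ _ => by positivity

/-- Comparison of the unit ball with the inscribed and the circumscribed cube. -/
theorem volume_unitBall_bounds (hι : 1 ≤ Fintype.card ι) :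
    (2 / √(Fintype.card ι)) ^ Fintype.card ι ≤
      volume.real (Metric.closedBall (0 : EuclideanSpace ℝ ι) 1) ∧
    volume.real (Metric.closedBall (0 : EuclideanSpace ℝ ι) 1) ≤ 2 ^ Fintype.card ι := by
  have hcube : ∀ a : ℝ, 0 ≤ a → volume.real ((WithLp.ofLp : EuclideanSpace ℝ ι → ι → ℝ) ⁻¹'
      Set.univ.pi fun _ => Set.Icc (-a) a) = (2 * a) ^ Fintype.card ι := by
    intro a ha
    rw [Measure.real, (PiLp.volume_preserving_ofLp ι).measure_preimage
      (MeasurableSet.univ_pi fun i => measurableSet_Icc).nullMeasurableSet, volume_pi_pi]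
    simp [ha, two_mul]
  have hpos : (0 : ℝ) < Fintype.card ι := by exact_mod_cast hι
  have hfin : volume (Metric.closedBall (0 : EuclideanSpace ℝ ι) 1) ≠ ⊤ :=
    measure_closedBall_lt_top.ne
  constructor
  · rw [div_eq_mul_inv, ← hcube _ (by positivity)]
    refine ENNReal.toReal_mono hfin (measure_mono fun v hv => ?_)
    simp only [Set.mem_preimage, Set.mem_pi, Set.mem_univ, forall_const, Set.mem_Icc,
      ← abs_le] at hv
    rw [mem_closedBall_zero_iff, EuclideanSpace.norm_eq, Real.sqrt_le_iff, one_pow]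
    refine ⟨zero_le_one, ?_⟩
    have : ∀ i ∈ Finset.univ, ‖v i‖ ^ 2 ≤ (Fintype.card ι : ℝ)⁻¹ := fun i _ => by
      rw [Real.norm_eq_abs, ← Real.sq_sqrt hpos.le, ← inv_pow]
      gcongr
      exact hv i
    refine (Finset.sum_le_card_nsmul _ _ _ this).trans (le_of_eq ?_)
    rw [nsmul_eq_mul, Finset.card_univ]
    field_simp
  · rw [← mul_one (2 : ℝ), ← hcube 1 zero_le_one]
    refine ENNReal.toReal_mono ?_ (measure_mono fun v hv => ?_)
    · rw [(PiLp.volume_preserving_ofLp ι).measure_preimage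
        (MeasurableSet.univ_pi fun i => measurableSet_Icc).nullMeasurableSet, volume_pi_pi]
      simp
    · rw [mem_closedBall_zero_iff] at hv
      simp only [Set.mem_preimage, Set.mem_pi, Set.mem_univ, forall_const, Set.mem_Icc, ← abs_le]
      exact fun i => (PiLp.norm_apply_le v i).trans hv

end Lattice

theorem half_three_quarters_rpow_le {D : ℕ} (hD : 1 ≤ D) :
    1 / 2 * (3 / 4 : ℝ) ^ ((D : ℝ) / 2) ≤ √(3 / 4 - 1 / (4 * (D : ℝ))) ^ D := by
  have hD' : (1 : ℝ) ≤ D := by exact_mod_cast hD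
  have h₁ : 1 / (3 * (D : ℝ)) ≤ 1 / 3 := by
    apply one_div_le_one_div_of_le <;> linarith
  have h₂ : (3 / 4 - 1 / (4 * (D : ℝ))) = 3 / 4 * (1 + -(1 / (3 * (D : ℝ)))) := by
    field_simp; ring
  refine (abs_le_of_sq_le_sq' ?_ (by positivity)).2
  rw [mul_pow, ← Real.rpow_mul_natCast (by norm_num), ← pow_mul, mul_comm D 2, pow_mul,
    Real.sq_sqrt (by rw [h₂]; exact mul_nonneg (by norm_num) (by linarith)), h₂, mul_pow]
  have h₃ := one_add_mul_le_pow (a := -(1 / (3 * (D : ℝ)))) (by linarith) D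
  have h₄ : 1 + (D : ℝ) * -(1 / (3 * (D : ℝ))) = 2 / 3 := by field_simp; ring
  rw [h₄] at h₃
  rw [show (D : ℝ) / 2 * (2 : ℕ) = D by push_cast; ring, Real.rpow_natCast]
  have h₅ : (0 : ℝ) < (3 / 4) ^ D := by positivity
  nlinarith

open MeasureTheory Metric in
theorem pow_mul_pow_div_le_eta {D n : ℕ} (hD : 1 ≤ D) {Q v : ℝ}
    (hv : v = volume.real (closedBall (0 : EuclideanSpace ℝ (Fin D)) 1))
    (hn : Q ^ D * v = n) (hQ : 12 * (D : ℝ) ^ 2 ≤ Q) :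
    √(3 / 4 - 1 / (4 * (D : ℝ))) ^ D / (120 * D * Q ^ 2) ≤ eta (3 * n) := by
  have hD' : (1 : ℝ) ≤ D := by exact_mod_cast hD
  have hQ₀ : 12 ≤ Q := by nlinarith
  have hdim : Fintype.card (Fin D) = D := by simp
  have hball : ∀ {a : ℝ}, 0 ≤ a →
      volume.real (closedBall (0 : EuclideanSpace ℝ (Fin D)) a) = a ^ D * v := by
    intro a ha
    rw [Measure.addHaar_real_closedBall' volume 0 ha, finrank_euclideanSpace_fin, ← hv]
  have hvpos : 0 < v := by
    have h := (volume_unitBall_bounds (ι := Fin D) (by simpa using hD)).1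
    rw [← hv, hdim] at h
    exact lt_of_lt_of_le (by positivity) h
  have hnpos : (0 : ℝ) < n := by rw [← hn]; positivity
  set s : ℝ := √D with hs
  have hs₁ : 1 ≤ s := Real.one_le_sqrt.2 hD'
  have hsD : s ≤ D := Real.sqrt_le_iff.2 ⟨by linarith, by nlinarith⟩
  have hsQ : 12 * s * D ≤ Q := by nlinarith
  have hsQ' : 12 * s ≤ Q := by nlinarith
  set ρ : ℝ := √(3 / 4 - 1 / (4 * (D : ℝ))) with hρ
  have hρ₂ : ρ ^ 2 = 3 / 4 - 1 / (4 * (D : ℝ)) := by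
    refine Real.sq_sqrt ?_
    have : 1 / (4 * (D : ℝ)) ≤ 1 / 4 := by apply one_div_le_one_div_of_le <;> linarith
    linarith
  have hρ₀ : 0 ≤ ρ := Real.sqrt_nonneg _
  set B := intBall (Fin D) (Q - s) with hB
  have hBn : B.card ≤ n := by
    have h := card_intBall_le (ι := Fin D) (Q - s)
    rw [hdim, ← hs, sub_add_cancel, hball (by linarith), hn] at h
    exact_mod_cast h
  have hM : ∀ x ∈ B, ∀ y ∈ B, ∑ i, (x i - y i) ^ 2 ≤ (⌊4 * (Q - s) ^ 2⌋₊ : ℤ) := by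
    intro x hx y hy
    rw [hB, mem_intBall] at hx hy
    rw [Int.natCast_floor_eq_floor (by positivity), Int.le_floor, ← norm_intPoint_sub_sq]
    calc _ ≤ ((Q - s) + (Q - s)) ^ 2 := by
          gcongr; exact (norm_sub_le _ _).trans (add_le_add hx hy)
      _ = _ := by ring
  refine le_trans ?_ (card_pairs_div_le_eta B hBn (fun x hx => by
    rw [hB, mem_intBall] at hx ⊢
    rwa [intPoint_neg, norm_neg]) hM)
  have hT := le_card_intBall_pairs (ι := Fin D) (r := Q - 2 * s) (by simpa using hD)
    (by linarith) hρ₀ (by rw [hdim]; exact hρ₂)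
  rw [hdim, ← hs, hball (by linarith), hball (mul_nonneg hρ₀ (by linarith)),
    show Q - 2 * s + s = Q - s by ring, show Q - 2 * s - s = Q - 3 * s by ring, ← hB] at hT
  have hpow : 1 / 2 * Q ^ (2 * D) ≤ (Q - 3 * s) ^ (2 * D) := by
    have h := one_add_mul_le_pow (a := -(3 * s / Q))
      (by rw [neg_le_neg_iff, div_le_iff₀] <;> linarith) (2 * D)
    have h₂ : 1 / 2 ≤ 1 + ((2 * D : ℕ) : ℝ) * -(3 * s / Q) := by
      have : ((2 * D : ℕ) : ℝ) * (3 * s / Q) ≤ 1 / 2 := by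
        rw [mul_div_assoc', div_le_iff₀ (by linarith)]
        push_cast
        nlinarith
      linarith
    calc _ ≤ (1 + -(3 * s / Q)) ^ (2 * D) * Q ^ (2 * D) := by gcongr; exact h₂.trans h
      _ = _ := by rw [← mul_pow]; congr 1; field_simp; ring
  have hT' : (n : ℝ) ^ 2 * ρ ^ D / (10 * D) ≤
      (((B ×ˢ B).filter fun p => p.1 + p.2 ∈ B).card : ℝ) := by
    refine le_trans ?_ hT
    calc (n : ℝ) ^ 2 * ρ ^ D / (10 * D) = 1 / 2 * Q ^ (2 * D) * v ^ 2 * ρ ^ D / (5 * D) := by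
          rw [← hn]; field_simp; ring
      _ ≤ (Q - 3 * s) ^ (2 * D) * v ^ 2 * ρ ^ D / (4 * D + 1) := by
          have : 0 ≤ Q - 3 * s := by linarith
          gcongr
          linarith
      _ = (Q - 3 * s) ^ D * v * ((ρ * (Q - 3 * s)) ^ D * v) / (4 * D + 1) := by
          rw [mul_pow]; ring
      _ ≤ _ := by
          have : 0 ≤ Q - 3 * s := by linarith
          gcongr
          linarith
  have hM' : (⌊4 * (Q - s) ^ 2⌋₊ : ℝ) + 1 ≤ 4 * Q ^ 2 := by
    have := Nat.floor_le (a := 4 * (Q - s) ^ 2) (by positivity)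
    nlinarith
  calc ρ ^ D / (120 * D * Q ^ 2)
      = (n : ℝ) ^ 2 * ρ ^ D / (10 * D) / (4 * Q ^ 2 * (3 * (n : ℝ) ^ 2)) := by
        field_simp; ring
    _ ≤ _ := by gcongr

theorem dimension_bound_le_eta {D n : ℕ} (hD : 1 ≤ D) (hn : (2 * D) ^ (100 * D) < n) :
    1 / 60 * (D : ℝ) ^ (-2 : ℝ) * (3 / 4 : ℝ) ^ ((D : ℝ) / 2) * (n : ℝ) ^ (-2 / (D : ℝ))
      ≤ eta (3 * n) := by
  have hD' : (1 : ℝ) ≤ D := by exact_mod_cast hD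
  have hD₀ : D ≠ 0 := by omega
  have hnpos : (0 : ℝ) < n := by exact_mod_cast (Nat.zero_le _).trans_lt hn
  set v := MeasureTheory.volume.real (Metric.closedBall (0 : EuclideanSpace ℝ (Fin D)) 1) with hv
  obtain ⟨hv₁, hv₂⟩ := volume_unitBall_bounds (ι := Fin D) (by simpa using hD)
  rw [← hv, Fintype.card_fin] at hv₁ hv₂
  have hvpos : 0 < v := lt_of_lt_of_le (by positivity) hv₁
  set Q : ℝ := ((n : ℝ) / v) ^ (D : ℝ)⁻¹ with hQ
  have hQ₀ : 0 ≤ Q := by positivity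
  have hQD : Q ^ D = n / v := Real.rpow_inv_natCast_pow (by positivity) hD₀
  have hQn : Q ^ D * v = n := by rw [hQD]; field_simp
  set N : ℝ := (n : ℝ) ^ (D : ℝ)⁻¹ with hN
  have hN₀ : 0 < N := by positivity
  have hND : N ^ D = n := Real.rpow_inv_natCast_pow (by positivity) hD₀
  have hQlarge : 12 * (D : ℝ) ^ 2 ≤ Q := by
    rw [← pow_le_pow_iff_left₀ (by positivity) hQ₀ hD₀, hQD, le_div_iff₀ hvpos]
    calc _ ≤ (12 * (D : ℝ) ^ 2) ^ D * 2 ^ D := by gcongr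
      _ = (24 * (D : ℝ) ^ 2) ^ D := by rw [← mul_pow]; ring
      _ ≤ ((2 * D : ℝ) ^ 100) ^ D := by
          gcongr
          calc 24 * (D : ℝ) ^ 2 ≤ 32 * (D : ℝ) ^ 5 := by
                gcongr <;> norm_num
            _ = (2 * D : ℝ) ^ 5 := by ring
            _ ≤ _ := by gcongr <;> linarith
      _ = ((2 * D) ^ (100 * D) : ℕ) := by push_cast; rw [← pow_mul]
      _ ≤ n := by exact_mod_cast hn.le
  have hQN : Q ^ 2 ≤ D / 4 * N ^ 2 := by
    have h : 2 / √(D : ℝ) * Q ≤ N := by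
      rw [← pow_le_pow_iff_left₀ (by positivity) hN₀.le hD₀, mul_pow, hND, ← hQn, mul_comm]
      gcongr
    calc Q ^ 2 = D / 4 * (2 / √(D : ℝ) * Q) ^ 2 := by
          rw [mul_pow, div_pow, Real.sq_sqrt (by positivity)]; field_simp; norm_num
      _ ≤ _ := by gcongr
  have hNn : (n : ℝ) ^ (-2 / (D : ℝ)) = (N ^ 2)⁻¹ := by
    rw [hN, ← Real.rpow_natCast, ← Real.rpow_mul hnpos.le, ← Real.rpow_neg hnpos.le]
    congr 1
    push_cast
    ring
  refine le_trans ?_ (pow_mul_pow_div_le_eta hD hv hQn hQlarge)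
  rw [hNn, Real.rpow_neg (by positivity), Real.rpow_two]
  have hQpos : 0 < Q := by nlinarith
  calc _ = 1 / 2 * (3 / 4 : ℝ) ^ ((D : ℝ) / 2) / (120 * D * (D / 4 * N ^ 2)) := by
        field_simp; norm_num
    _ ≤ _ := by
        gcongr
        exact half_three_quarters_rpow_le hD

theorem tendsto_logb_ten_mul_div :
    Tendsto (fun x : ℝ => Real.logb 2 (10 * x) / x) atTop (𝓝 0) := by
  have h := (Real.isLittleO_log_id_atTop.tendsto_div_nhds_zero.comp
    (tendsto_id.const_mul_atTop (by norm_num : (0 : ℝ) < 10))).const_mul (10 / Real.log 2)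
  rw [mul_zero] at h
  refine h.congr fun x => ?_
  simp only [Function.comp_apply, id, Real.logb]
  rcases eq_or_ne x 0 with rfl | hx
  · simp
  · have : Real.log 2 ≠ 0 := (Real.log_pos one_lt_two).ne'
    field_simp

theorem eta_lower_bound_of_large {n : ℕ} {x : ℝ} (hx : 1 ≤ x) (hnx : (n : ℝ) = 2 ^ x ^ 2)
    (hlarge : 500 * (Real.logb 2 (10 * x) / x) + 3 / x ^ 2 ≤ 1) :
    1 / 480 * (2 : ℝ) ^ (-(2 * √(Real.logb 2 (4 / 3)) + 2 * (Real.logb 2 (10 * x) / x)) * x)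
      ≤ eta n := by
  have hx₀ : 0 < x := by linarith
  set a := Real.logb 2 (4 / 3) with ha
  have ha₁ : 1 / 4 ≤ a := by
    rw [ha, Real.le_logb_iff_rpow_le one_lt_two (by norm_num)]
    rw [← pow_le_pow_iff_left₀ (by positivity) (by norm_num) four_ne_zero,
      ← Real.rpow_mul_natCast (by norm_num)]
    norm_num
  have ha₂ : a ≤ 1 := by
    rw [ha, Real.logb_le_iff_le_rpow one_lt_two (by norm_num)]
    norm_num
  set α := √a with hα
  have hα₂ : α * α = a := Real.mul_self_sqrt (by linarith)
  have hα₀ : 1 / 2 ≤ α := Real.le_sqrt_of_sq_le (by norm_num; linarith)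
  set D := ⌈2 * x / α⌉₊ with hD
  have hD₁ : 2 * x / α ≤ D := Nat.le_ceil _
  have hD₂ : (D : ℝ) < 2 * x / α + 1 := Nat.ceil_lt_add_one (by positivity)
  have hDpos : 0 < D := Nat.ceil_pos.2 (by positivity)
  have hDpos' : (0 : ℝ) < D := by exact_mod_cast hDpos
  have hD₃ : (D : ℝ) ≤ 5 * x := by
    have : 2 * x / α ≤ 4 * x := by rw [div_le_iff₀ (by linarith)]; nlinarith
    linarith
  set l := Real.logb 2 (10 * x) with hl
  have hl₂ : (2 : ℝ) ^ l = 10 * x := Real.rpow_logb two_pos (by norm_num) (by positivity)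
  have hl₀ : 0 ≤ l := Real.logb_nonneg one_lt_two (by linarith)
  have hlarge' : 500 * (l * x) + 3 ≤ x ^ 2 := by
    have h := mul_le_mul_of_nonneg_right hlarge (sq_nonneg x)
    rwa [add_mul, one_mul, div_mul_cancel₀ _ (by positivity),
      show 500 * (l / x) * x ^ 2 = 500 * (l * x) by field_simp] at h
  have hpow : 8 * (2 * D) ^ (100 * D) ≤ n := by
    have h : 8 * ((2 * D : ℝ)) ^ (100 * D) ≤ n := by
      calc 8 * ((2 * D : ℝ)) ^ (100 * D) ≤ 8 * ((2 : ℝ) ^ l) ^ (100 * D) := by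
            gcongr; rw [hl₂]; linarith
        _ = (2 : ℝ) ^ (3 + l * (100 * D : ℕ)) := by
            rw [Real.rpow_add two_pos, Real.rpow_mul_natCast two_pos.le]; norm_num
        _ ≤ (2 : ℝ) ^ x ^ 2 := by
            refine Real.rpow_le_rpow_of_exponent_le one_le_two ?_
            push_cast
            nlinarith [mul_le_mul_of_nonneg_left hD₃ hl₀]
        _ = n := hnx.symm
    exact_mod_cast h
  have hpow₁ : 1 ≤ (2 * D) ^ (100 * D) := Nat.one_le_pow _ _ (by omega)
  set m := n / 3 with hm
  have hm₀ : 0 < m := by omega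
  have hm₁ : (1 / 2 : ℝ) ≤ ((3 * m : ℕ) : ℝ) / n := by
    rw [le_div_iff₀ (by rw [hnx]; positivity)]
    have : n ≤ 2 * (3 * m) := by omega
    have : (n : ℝ) ≤ 2 * (3 * m : ℕ) := by exact_mod_cast this
    linarith
  have hmn : (m : ℝ) ≤ n := by exact_mod_cast Nat.div_le_self n 3
  have hm₀' : (0 : ℝ) < m := by exact_mod_cast hm₀
  have hbound := dimension_bound_le_eta (D := D) (n := m) hDpos (by omega)
  have hmono := eta_mul_sq_mono (m := 3 * m) (n := n) (by omega) (by omega)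
  have f₁ : (2 : ℝ) ^ (-(2 * l)) ≤ (D : ℝ) ^ (-2 : ℝ) := by
    rw [← mul_neg, mul_comm, neg_eq_neg_one_mul, mul_comm (-1) l, mul_assoc,
      Real.rpow_mul two_pos.le, hl₂, neg_one_mul]
    exact Real.rpow_le_rpow_of_nonpos hDpos' (by linarith) (by norm_num)
  have f₂ : 1 / 2 * (2 : ℝ) ^ (-(α * x)) ≤ (3 / 4 : ℝ) ^ ((D : ℝ) / 2) := by
    have e : (3 / 4 : ℝ) = 2 ^ (-a) := by
      rw [Real.rpow_neg two_pos.le, ha, Real.rpow_logb two_pos (by norm_num) (by norm_num)]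
      norm_num
    rw [e, ← Real.rpow_mul two_pos.le, show (1 / 2 : ℝ) = 2 ^ (-1 : ℝ) by
      rw [Real.rpow_neg_one]; norm_num, ← Real.rpow_add two_pos]
    refine Real.rpow_le_rpow_of_exponent_le one_le_two ?_
    have h : a * (2 * x / α) = 2 * (α * x) := by rw [← hα₂]; field_simp
    have := mul_le_mul_of_nonneg_left hD₂.le (by linarith : 0 ≤ a)
    linarith
  have f₃ : (2 : ℝ) ^ (-(α * x)) ≤ (m : ℝ) ^ (-2 / (D : ℝ)) := by
    calc (2 : ℝ) ^ (-(α * x)) ≤ 2 ^ (x ^ 2 * (-2 / (D : ℝ))) := by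
          refine Real.rpow_le_rpow_of_exponent_le one_le_two ?_
          rw [mul_div_assoc', le_div_iff₀ hDpos']
          rw [div_le_iff₀ (by linarith)] at hD₁
          nlinarith
      _ = (n : ℝ) ^ (-2 / (D : ℝ)) := by rw [hnx, ← Real.rpow_mul two_pos.le]
      _ ≤ _ := Real.rpow_le_rpow_of_nonpos hm₀' hmn
          (div_nonpos_of_nonpos_of_nonneg (by norm_num) hDpos'.le)
  calc 1 / 480 * (2 : ℝ) ^ (-(2 * α + 2 * (l / x)) * x)
      = 1 / 60 * (2 : ℝ) ^ (-(2 * l)) * (1 / 2 * (2 : ℝ) ^ (-(α * x))) * 2 ^ (-(α * x)) *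
          (1 / 2) ^ 2 := by
        rw [show -(2 * α + 2 * (l / x)) * x = -(2 * l) + -(α * x) + -(α * x) by field_simp; ring,
          Real.rpow_add two_pos, Real.rpow_add two_pos]
        ring
    _ ≤ 1 / 60 * (D : ℝ) ^ (-2 : ℝ) * (3 / 4 : ℝ) ^ ((D : ℝ) / 2) * (m : ℝ) ^ (-2 / (D : ℝ)) *
          (((3 * m : ℕ) : ℝ) / n) ^ 2 := by gcongr
    _ ≤ eta (3 * m) * (((3 * m : ℕ) : ℝ) / n) ^ 2 := by gcongr
    _ ≤ eta n := hmono

theorem theorem1 :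
    (∃ c : ℝ, 0 < c ∧ ∃ C : ℝ, 0 < C ∧
      ∀ D n : ℕ, 1 ≤ D → (2 * D) ^ (100 * D) < n →
        c * (D : ℝ) ^ (-C) * (3 / 4 : ℝ) ^ ((D : ℝ) / 2) * (n : ℝ) ^ (-2 / (D : ℝ))
          ≤ eta (3 * n)) ∧
    (∃ ε : ℕ → ℝ, Tendsto ε atTop (𝓝 0) ∧ ∃ c : ℝ, 0 < c ∧
      ∀ᶠ n : ℕ in atTop,
        c * (2 : ℝ) ^ (-(2 * √(Real.logb 2 (4 / 3)) + ε n) * √(Real.logb 2 (n : ℝ)))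
          ≤ eta n) := by
  refine ⟨⟨1 / 60, by norm_num, 2, two_pos, fun D n hD hn => dimension_bound_le_eta hD hn⟩, ?_⟩
  have hx : Tendsto (fun n : ℕ => √(Real.logb 2 (n : ℝ))) atTop atTop :=
    Real.tendsto_sqrt_atTop.comp
      ((Real.tendsto_logb_atTop one_lt_two).comp tendsto_natCast_atTop_atTop)
  refine ⟨fun n => 2 * (Real.logb 2 (10 * √(Real.logb 2 (n : ℝ))) / √(Real.logb 2 (n : ℝ))),
    by simpa using (tendsto_logb_ten_mul_div.comp hx).const_mul 2, 1 / 480, by norm_num, ?_⟩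
  have hlim : Tendsto (fun x : ℝ => 500 * (Real.logb 2 (10 * x) / x) + 3 / x ^ 2) atTop (𝓝 0) := by
    simpa using (tendsto_logb_ten_mul_div.const_mul 500).add
      ((tendsto_pow_atTop (α := ℝ) two_ne_zero).const_div_atTop 3)
  filter_upwards [hx.eventually_ge_atTop 1, hx.eventually (hlim.eventually_le_const one_pos),
    eventually_ge_atTop 1] with n h₁ h₂ h₃
  refine eta_lower_bound_of_large h₁ ?_ h₂
  have hn : (1 : ℝ) ≤ n := by exact_mod_cast h₃
  rw [Real.sq_sqrt (Real.logb_nonneg one_lt_two hn),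
    Real.rpow_logb two_pos (by norm_num) (by linarith)]
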